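/- All graphs are finite and simple. For a connected graph $G$, a set $S\subseteq E(G)$ is an anti-Kekulé set if $G-S$ (the graph obtained by deleting the edges in $S$) is connected and has no perfect matching; the anti-Kekulé number $ak(G)$ is the smallest cardinality of an anti-Kekulé set of $G$. A $(3,6)$-fullerene is a $2$-connected cubic plane graph all of whose faces (including the outer face) are triangles or hexagons; in particular, every $3$-connected cubic plane graph all of whose faces are triangles or hexagons is a $(3,6)$-fullerene. **Theorem.** If $G$ is a $(3,6)$-fullerene, then $ak(G)=3$. In particular, $G$ has an anti-Kekulé set. -/

import Mathlib

namespace SimpleGraph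

variable {V : Type*}

/-- `G` is `k`-connected: it has more than `k` vertices, and it stays connected whenever fewer than
`k` vertices are deleted. -/
def IsVertexConnected (G : SimpleGraph V) (k : ℕ) : Prop :=
  (k : ℕ∞) < ENat.card V ∧
    ∀ X : Set V, X.encard < (k : ℕ∞) → (G.induce Xᶜ).Connected

/-- `S` is an anti-Kekulé set of `G`: a set of edges of `G` such that `G - S` is connected and has
no perfect matching. -/
structure IsAntiKekuleSet (G : SimpleGraph V) (S : Set (Sym2 V)) : Prop where
  subset_edgeSet : S ⊆ G.edgeSet
  connected : (G.deleteEdges S).Connected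
  no_perfectMatching : ¬ ∃ M : (G.deleteEdges S).Subgraph, M.IsPerfectMatching

/-- The anti-Kekulé number: the smallest size of an anti-Kekulé set, and `⊤` if there is none. -/
noncomputable def antiKekuleNumber (G : SimpleGraph V) : ℕ∞ :=
  ⨅ S ∈ {S : Set (Sym2 V) | G.IsAntiKekuleSet S}, S.encard

/-- A rotation system on `G` (a cellular embedding of `G` in a closed oriented surface, up to
equivalence): a permutation of the darts (directed edges) of `G` whose cycles are exactly
the sets of darts leaving a common vertex. `next d` is the dart that follows `d` in the cyclic
order around its initial vertex. -/
structure RotationSystem (G : SimpleGraph V) where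
  next : Equiv.Perm G.Dart
  sameCycle_next_iff : ∀ d d' : G.Dart, next.SameCycle d d' ↔ d.fst = d'.fst

namespace RotationSystem

variable {G : SimpleGraph V}

/-- Reversal of darts, as a permutation. -/
def reverse (G : SimpleGraph V) : Equiv.Perm G.Dart :=
  Function.Involutive.toPerm Dart.symm Dart.symm_involutive

/-- The permutation that walks along the boundaries of the faces: after the dart `u → v` comes the
dart leaving `v` that follows `v → u` in the rotation at `v`. -/
def facePerm (R : G.RotationSystem) : Equiv.Perm G.Dart := R.next * reverse G

/-- The faces of the embedding: the cycles of the face permutation. -/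
def Face (R : G.RotationSystem) : Type _ :=
  Quotient (Equiv.Perm.SameCycle.setoid R.facePerm)

/-- The face whose boundary walk contains a given dart. -/
def faceOf (R : G.RotationSystem) (d : G.Dart) : R.Face :=
  Quotient.mk (Equiv.Perm.SameCycle.setoid R.facePerm) d

/-- The length of the boundary walk of a face. -/
noncomputable def faceLength (R : G.RotationSystem) (f : R.Face) : ℕ :=
  {d : G.Dart | R.faceOf d = f}.ncard

/-- For a finite connected graph with at least one edge: the surface of the embedding is the sphere,
i.e. its Euler characteristic is `2`, so that `G` with this rotation system is a plane graph. -/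
def IsPlane (R : G.RotationSystem) : Prop :=
  Nat.card V + Nat.card R.Face = G.edgeSet.ncard + 2

end RotationSystem

/-- `G` with the rotation system `R` is a `(3,6)`-fullerene: a 2-connected cubic plane graph all of
whose faces are triangles or hexagons. (The connectivity of such a graph is `2` or `3`.) -/
structure IsThreeSixFullerene (G : SimpleGraph V) [G.LocallyFinite]
    (R : G.RotationSystem) : Prop where
  twoConnected : G.IsVertexConnected 2
  cubic : G.IsRegularOfDegree 3
  plane : R.IsPlane
  face : ∀ f : R.Face, R.faceLength f = 3 ∨ R.faceLength f = 6

end SimpleGraph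

/-!
The embedding is needed only to find a triangle: if every face were a hexagon, double counting of
darts would give `6 |F| = 2 |E| = 3 |V|`, so that `|V| - |E| + |F| = 0`, against Euler's formula.
The rest holds in every 2-connected cubic graph with a triangle.

*Upper bound* (`exists_isAntiKekuleSet_of_triangle`). Let `v x y` be a triangle and let `x'`, `y'`
be the third neighbours of `x` and `y`. Delete the three edges `xy`, `xx'` and `yy'`. Then `x` and
`y` both become pendant vertices attached to `v`, so no perfect matching can cover both. The graph
stays connected: a set of vertices that splits off sends at most the edges at `x`, at `y` and at `v`
out of the triangle, and 2-connectedness, used three times, excludes this.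

*Lower bound* (`exists_isPerfectMatching_deleteEdges`, the cubic case of a theorem of Plesník).
Deleting at most two edges of a 2-connected cubic graph leaves a perfect matching. Otherwise Tutte's
theorem gives a set `X` such that more than `|X|`, hence by parity at least `|X| + 2`, odd components
remain after deletion of `X`. A set of odd size has an edge boundary of odd size, which cannot be `1`
in a 2-connected cubic graph (`three_le_card_dartBoundary`). So at least `3 |X| + 6` edges,
counted once for each odd component that they leave, come out of the odd components. But at most
`3 |X|` of them end in `X`, and each of the two deleted edges is counted at most twice.
-/

namespace SimpleGraph

variable {V : Type*} {G : SimpleGraph V}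

/-! ### Connectedness through sets closed under adjacency -/

lemma connected_of_forall_closed (v : V)
    (h : ∀ A : Set V, v ∈ A → (∀ a ∈ A, ∀ b, G.Adj a b → b ∈ A) → ∀ b, b ∈ A) :
    G.Connected :=
  (connected_iff_exists_forall_reachable G).2 ⟨v, h {w | G.Reachable v w} (Reachable.refl v)
    fun _ ha _ hab => Reachable.trans ha hab.reachable⟩

/-- In a 2-connected graph, a nonempty set of vertices that can be left only through one vertex
`w` contains every vertex other than `w`. -/
lemma IsVertexConnected.mem_of_closed (h : G.IsVertexConnected 2) {w : V} {A : Set V}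
    (hA : A.Nonempty) (hw : w ∉ A) (hcl : ∀ a ∈ A, ∀ b, G.Adj a b → b = w ∨ b ∈ A)
    {b : V} (hb : b ≠ w) : b ∈ A := by
  obtain ⟨a, ha⟩ := hA
  have hc := h.2 {w} (by simp)
  have key : ∀ x y : ({w}ᶜ : Set V), (G.induce {w}ᶜ).Walk x y → x.1 ∈ A → y.1 ∈ A := by
    intro x y p
    induction p with
    | nil => exact id
    | @cons x z y hxz _ ih =>
      intro hx
      exact ih ((hcl x.1 hx z.1 hxz).resolve_left z.2)
  have haw : a ≠ w := fun e => hw (e ▸ ha)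
  obtain ⟨p⟩ := hc.preconnected ⟨a, haw⟩ ⟨b, hb⟩
  exact key _ _ p ha

/-! ### Edge boundaries in cubic graphs -/

/-- Regularity does not depend on the chosen enumeration of the neighbours. -/
lemma IsRegularOfDegree.of_locallyFinite {i : G.LocallyFinite} {k : ℕ}
    (h : @IsRegularOfDegree V G i k) (j : G.LocallyFinite) : @IsRegularOfDegree V G j k := by
  intro v
  convert h v

section Boundary

open Finset
open scoped Classical

variable [Fintype V]

/-- The edge boundary of a set `C` of vertices, each edge being represented by the dart that leaves
`C` along it. -/
noncomputable def dartBoundary (G : SimpleGraph V) (C : Set V) : Finset G.Dart :=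
  {d | d.fst ∈ C ∧ d.snd ∉ C}

lemma mem_dartBoundary {C : Set V} {d : G.Dart} :
    d ∈ G.dartBoundary C ↔ d.fst ∈ C ∧ d.snd ∉ C := by
  simp [dartBoundary]

lemma IsRegularOfDegree.card_darts_fst_mem {k : ℕ} (h : G.IsRegularOfDegree k) (C : Set V) :
    #{d : G.Dart | d.fst ∈ C} = k * C.ncard := by
  rw [Set.ncard_eq_toFinset_card', mul_comm,
    card_eq_sum_card_fiberwise (f := fun d : G.Dart => d.fst) (t := C.toFinset)
      (by intro d hd; simpa using hd)]
  refine sum_const_nat fun v hv => ?_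
  rw [← h v, ← G.dart_fst_fiber_card_eq_degree v, filter_filter]
  congr 1
  ext d
  simp only [mem_filter, mem_univ, true_and, and_iff_right_iff_imp]
  rintro rfl
  simpa using hv

lemma IsRegularOfDegree.card_darts_snd_mem {k : ℕ} (h : G.IsRegularOfDegree k) (C : Set V) :
    #{d : G.Dart | d.snd ∈ C} = k * C.ncard := by
  rw [← h.card_darts_fst_mem C]
  exact card_bij' (fun d _ => d.symm) (fun d _ => d.symm) (by simp) (by simp) (by simp) (by simp)

lemma even_card_darts_inside (C : Set V) :
    Even #{d : G.Dart | d.fst ∈ C ∧ d.snd ∈ C} := by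
  rw [← ZMod.natCast_eq_zero_iff_even, card_eq_sum_ones, Nat.cast_sum]
  refine sum_involution (fun d _ => d.symm) ?_ ?_ ?_ ?_
  · intro d _
    decide
  · intro d _ _
    exact d.symm_ne
  · intro d hd
    simp only [mem_filter, mem_univ, true_and] at hd ⊢
    exact hd.symm
  · simp

lemma IsRegularOfDegree.odd_card_dartBoundary {k : ℕ} (h : G.IsRegularOfDegree k) (hk : Odd k)
    {C : Set V} (hC : Odd C.ncard) : Odd #(G.dartBoundary C) := by
  have h1 := h.card_darts_fst_mem C
  rw [← card_filter_add_card_filter_not (fun d : G.Dart => d.snd ∈ C), filter_filter,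
    filter_filter] at h1
  have h2 : Odd (k * C.ncard) := hk.mul hC
  rw [← h1] at h2
  exact (Nat.odd_add'.1 h2).2 (even_card_darts_inside C)

/-- If a single edge left `C`, then its end in `C` would be a cut vertex, unless it were all of `C`;
but a single vertex has three edges. -/
lemma three_le_card_dartBoundary (h2 : G.IsVertexConnected 2) (h : G.IsRegularOfDegree 3)
    {C : Set V} (hC : Odd C.ncard) : 3 ≤ #(G.dartBoundary C) := by
  have hodd := h.odd_card_dartBoundary (by decide) hC
  by_contra hlt
  have h1 : #(G.dartBoundary C) = 1 := by
    obtain ⟨m, hm⟩ := hodd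
    omega
  obtain ⟨d, hd⟩ := card_eq_one.1 h1
  have hdm : d.fst ∈ C ∧ d.snd ∉ C := mem_dartBoundary.1 (hd ▸ mem_singleton_self d)
  have huniq : ∀ a ∈ C, ∀ b, G.Adj a b → b ∉ C → a = d.fst := by
    intro a ha b hab hb
    have : (⟨(a, b), hab⟩ : G.Dart) ∈ G.dartBoundary C := mem_dartBoundary.2 ⟨ha, hb⟩
    rw [hd, mem_singleton] at this
    rw [← this]
  have hne : (C \ {d.fst}).Nonempty := by
    by_contra hemp
    have hCs : C = {d.fst} :=
      (Set.sdiff_eq_empty.1 (Set.not_nonempty_iff_eq_empty.1 hemp)).antisymm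
        (Set.singleton_subset_iff.2 hdm.1)
    have h3 := h.card_darts_fst_mem C
    have : G.dartBoundary C = ({d' | d'.fst ∈ C} : Finset G.Dart) := by
      ext d'
      rw [mem_dartBoundary, hCs]
      simp only [Set.mem_singleton_iff, mem_filter, mem_univ, true_and, and_iff_left_iff_imp]
      rintro e e'
      exact d'.fst_ne_snd (e.trans e'.symm)
    rw [← this, h1, hCs, Set.ncard_singleton] at h3
    omega
  have hmem := h2.mem_of_closed (w := d.fst) hne (by simp)
    (fun a ha b hab => by
      by_contra hb
      push Not at hb
      exact ha.2 (huniq a ha.1 b hab fun hbC => hb.2 ⟨hbC, hb.1⟩)) d.snd_ne_fst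
  exact hdm.2 hmem.1

/-! ### Perfect matchings after deletion of two edges -/

lemma card_darts_edge_mem_le (S : Finset (Sym2 V)) :
    #{d : G.Dart | d.edge ∈ S} ≤ 2 * #S := by
  refine card_le_mul_card_image_of_maps_to (f := Dart.edge) (by simp) 2 fun e _ => ?_
  by_cases he : e ∈ G.edgeSet
  · rw [← G.dart_edge_fiber_card e he]
    exact card_le_card (filter_subset_filter _ (subset_univ _))
  · rw [filter_false_of_mem]
    · simp
    · rintro d _ rfl
      exact he d.edge_mem

/-- In a cubic graph in which every odd set of vertices has at least three boundary edges, a perfect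
matching survives the deletion of any two edges. -/
theorem exists_isPerfectMatching_deleteEdges (h : G.IsRegularOfDegree 3)
    (hcut : ∀ C : Set V, Odd C.ncard → 3 ≤ #(G.dartBoundary C))
    (S : Finset (Sym2 V)) (hS : #S ≤ 2) :
    ∃ M : (G.deleteEdges (S : Set (Sym2 V))).Subgraph, M.IsPerfectMatching := by
  rw [tutte]
  intro X hX
  unfold IsTutteViolator at hX
  set D := ((⊤ : (G.deleteEdges (S : Set (Sym2 V))).Subgraph).deleteVerts X) with hD
  have hverts : D.verts = Xᶜ := by
    rw [hD, Subgraph.deleteVerts_verts, Subgraph.verts_top, Set.compl_eq_univ_sdiff]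
  have heven : Even (Fintype.card V) := by
    have h1 := G.sum_degrees_eq_twice_card_edges
    rw [sum_congr rfl fun v _ => h v, sum_const, card_univ, smul_eq_mul] at h1
    rw [Nat.even_iff]
    omega
  have hcardD : Nat.card D.verts + X.ncard = Fintype.card V := by
    rw [Nat.card_coe_set_eq, hverts, add_comm, Set.ncard_add_ncard_compl,
      Nat.card_eq_fintype_card]
  have hpar := odd_ncard_oddComponents D.coe
  set K := D.coe.oddComponents.toFinite.toFinset with hK
  have hKcard : D.coe.oddComponents.ncard = #K :=
    Set.ncard_eq_toFinset_card _ _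
  -- `|X|` and the number of odd components have the same parity, since `|V|` is even.
  have hKge : X.ncard + 2 ≤ #K := by
    rw [hKcard] at hX hpar
    rw [Nat.even_iff] at heven
    rw [Nat.odd_iff, Nat.odd_iff] at hpar
    omega
  let B : D.coe.ConnectedComponent → Finset G.Dart :=
    fun c => G.dartBoundary (Subtype.val '' c.supp)
  have hdisj : (K : Set D.coe.ConnectedComponent).PairwiseDisjoint B := by
    intro c _ c' _ hcc'
    refine Finset.disjoint_left.2 fun d hd hd' => ?_
    obtain ⟨a, ha, hda⟩ := (mem_dartBoundary.1 hd).1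
    obtain ⟨b, hb, hdb⟩ := (mem_dartBoundary.1 hd').1
    obtain rfl : a = b := Subtype.ext (hda.trans hdb.symm)
    exact hcc' (ha.symm.trans hb)
  have hlow : 3 * #K ≤ #(K.biUnion B) := by
    rw [card_biUnion hdisj, mul_comm]
    refine card_nsmul_le_sum K _ 3 fun c hc => hcut _ ?_
    rw [Set.ncard_image_of_injective _ Subtype.val_injective]
    simpa [hK] using hc
  -- An edge that leaves a component of `D` ends in `X` or has been deleted.
  have hsub : K.biUnion B ⊆
      ({d | d.snd ∈ X} : Finset G.Dart) ∪ ({d | d.edge ∈ S} : Finset G.Dart) := by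
    intro d hd
    obtain ⟨c, _, hdc⟩ := mem_biUnion.1 hd
    obtain ⟨⟨a, ha, hda⟩, hout⟩ := mem_dartBoundary.1 hdc
    simp only [mem_union, mem_filter, mem_univ, true_and]
    by_contra hcon
    push Not at hcon
    have hsnd : d.snd ∈ D.verts := by
      rw [hverts]
      exact hcon.1
    refine hout ⟨⟨d.snd, hsnd⟩, ?_, rfl⟩
    have hadj : D.coe.Adj a ⟨d.snd, hsnd⟩ := by
      have haX : a.1 ∈ Xᶜ := hverts ▸ a.2
      refine Subgraph.deleteVerts_adj.2 ⟨trivial, haX, trivial, hcon.1, ?_⟩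
      rw [Subgraph.top_adj, deleteEdges_adj, hda]
      exact ⟨d.adj, hcon.2⟩
    rw [ConnectedComponent.mem_supp_iff] at ha ⊢
    rw [← ha]
    exact (ConnectedComponent.connectedComponentMk_eq_of_adj hadj).symm
  have hup := (card_le_card hsub).trans (card_union_le _ _)
  rw [h.card_darts_snd_mem X] at hup
  have := card_darts_edge_mem_le (G := G) S
  omega

end Boundary

/-! ### Three edges at a triangle -/

lemma exists_third_neighbor {v x y : V} (h : (G.neighborSet v).ncard = 3) (hx : G.Adj v x)
    (hy : G.Adj v y) (hxy : x ≠ y) :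
    ∃ z, z ≠ x ∧ z ≠ y ∧ ∀ w, G.Adj v w ↔ w = x ∨ w = y ∨ w = z := by
  obtain ⟨a, b, c, hab, hac, hbc, he⟩ := Set.ncard_eq_three.1 h
  have hmem : ∀ w, G.Adj v w ↔ w = a ∨ w = b ∨ w = c := by
    intro w
    rw [← mem_neighborSet, he]
    simp
  have hx' := (hmem x).1 hx
  have hy' := (hmem y).1 hy
  simp only [hmem]
  rcases hx' with rfl | rfl | rfl <;> rcases hy' with rfl | rfl | rfl
  all_goals first
    | exact absurd rfl hxy
    | exact ⟨c, by grind⟩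
    | exact ⟨b, by grind⟩
    | exact ⟨a, by grind⟩

/-- The set consists of the edge `xy` and the edges at `x` and `y` that leave the triangle; it turns
`x` and `y` into pendant vertices with the same neighbour `v`. -/
theorem exists_isAntiKekuleSet_of_triangle (h2 : G.IsVertexConnected 2)
    (h3 : ∀ v, (G.neighborSet v).ncard = 3) {v x y : V} (hvx : G.Adj v x) (hxy : G.Adj x y)
    (hyv : G.Adj y v) : ∃ S, G.IsAntiKekuleSet S ∧ S.encard ≤ 3 := by
  obtain ⟨v', hv'x, hv'y, hv⟩ := exists_third_neighbor (h3 v) hvx hyv.symm hxy.ne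
  obtain ⟨x', hx'v, hx'y, hx⟩ := exists_third_neighbor (h3 x) hvx.symm hxy hyv.ne'
  obtain ⟨y', hy'v, hy'x, hy⟩ := exists_third_neighbor (h3 y) hyv hxy.symm hvx.ne
  have hvx' := hvx.ne
  have hxy' := hxy.ne
  have hyv' := hyv.ne
  have hGxx' : G.Adj x x' := (hx x').2 (by simp)
  have hGyy' : G.Adj y y' := (hy y').2 (by simp)
  have hGvv' : G.Adj v v' := (hv v').2 (by simp)
  set S : Set (Sym2 V) := {s(x, y), s(x, x'), s(y, y')} with hS
  have hHx : ∀ w, (G.deleteEdges S).Adj x w ↔ w = v := by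
    intro w
    rw [deleteEdges_adj, hx w]
    simp only [hS, Set.mem_insert_iff, Set.mem_singleton_iff, Sym2.eq_iff]
    grind
  have hHy : ∀ w, (G.deleteEdges S).Adj y w ↔ w = v := by
    intro w
    rw [deleteEdges_adj, hy w]
    simp only [hS, Set.mem_insert_iff, Set.mem_singleton_iff, Sym2.eq_iff]
    grind
  have hHother : ∀ a b, a ≠ x → a ≠ y → b ≠ x → b ≠ y → G.Adj a b →
      (G.deleteEdges S).Adj a b := by
    intro a b hax hay hbx hby hab
    rw [deleteEdges_adj]
    refine ⟨hab, ?_⟩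
    simp only [hS, Set.mem_insert_iff, Set.mem_singleton_iff, Sym2.eq_iff]
    grind
  refine ⟨S, ⟨?_, ?_, ?_⟩, ?_⟩
  · rintro e (rfl | rfl | rfl)
    exacts [hxy, hGxx', hGyy']
  · refine connected_of_forall_closed v fun A hvA hcl b => ?_
    have hxA : x ∈ A := hcl v hvA x ((hHx v).2 rfl).symm
    have hyA : y ∈ A := hcl v hvA y ((hHy v).2 rfl).symm
    have hv'A : v' ∈ A :=
      hcl v hvA v' (hHother v v' hvx' hyv'.symm hv'x hv'y hGvv')
    by_contra hb
    -- In `G`, the complement of `A` is joined to `A` by edges at `x` and `y` only.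
    have hB : ∀ a ∉ A, ∀ c, G.Adj a c → c = x ∨ c = y ∨ c ∉ A := by
      intro a ha c hac
      by_contra hc
      push Not at hc
      have hax : a ≠ x := fun e => ha (e ▸ hxA)
      have hay : a ≠ y := fun e => ha (e ▸ hyA)
      exact ha (hcl c hc.2.2 a (hHother a c hax hay hc.1 hc.2.1 hac).symm)
    -- Since neither `y` nor `x` is a cut vertex, both edges `xx'` and `yy'` lead out of `A`.
    have hx'A : x' ∉ A := by
      intro hx'A
      have hno : ∀ a ∉ A, ¬ G.Adj a x := by
        intro a ha hax
        rcases (hx a).1 hax.symm with rfl | rfl | rfl <;> contradiction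
      exact h2.mem_of_closed (w := y) (A := Aᶜ) ⟨b, hb⟩ (by simpa using hyA)
        (fun a ha c hac => (hB a ha c hac).resolve_left fun e => hno a ha (e ▸ hac)) hxy' hxA
    have hy'A : y' ∉ A := by
      intro hy'A
      have hno : ∀ a ∉ A, ¬ G.Adj a y := by
        intro a ha hay
        rcases (hy a).1 hay.symm with rfl | rfl | rfl <;> contradiction
      refine h2.mem_of_closed (w := x) (A := Aᶜ) ⟨b, hb⟩ (by simpa using hxA)
        (fun a ha c hac => ?_) hxy'.symm hyA
      rcases hB a ha c hac with e | e | e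
      · exact Or.inl e
      · exact absurd (e ▸ hac) (hno a ha)
      · exact Or.inr e
    -- Hence `v` separates `x`, `y` and the complement of `A` from `v'`.
    have hfin := h2.mem_of_closed (w := v) (A := Aᶜ ∪ {x, y}) ⟨b, Or.inl hb⟩
      (by simp [hvA, hvx', hyv'.symm]) (by
        rintro a (ha | rfl | rfl) c hac
        · rcases hB a ha c hac with rfl | rfl | e
          · simp
          · simp
          · exact Or.inr (Or.inl e)
        · rcases (hx c).1 hac with rfl | rfl | rfl
          · simp
          · simp
          · exact Or.inr (Or.inl hx'A)
        · rcases (hy c).1 hac with rfl | rfl | rfl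
          · simp
          · simp
          · exact Or.inr (Or.inl hy'A)) hGvv'.ne'
    simp [hv'A, hv'x, hv'y] at hfin
  · rintro ⟨M, hM, hMs⟩
    obtain ⟨w, hw, -⟩ := hM (hMs x)
    obtain ⟨z, hz, -⟩ := hM (hMs y)
    obtain rfl := (hHx w).1 hw.adj_sub
    obtain rfl := (hHy z).1 hz.adj_sub
    exact hxy' (hM.eq_of_adj_right hw hz)
  · calc S.encard ≤ ({s(x, x'), s(y, y')} : Set (Sym2 V)).encard + 1 := Set.encard_insert_le _ _
      _ ≤ ({s(y, y')} : Set (Sym2 V)).encard + 1 + 1 := by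
        gcongr
        exact Set.encard_insert_le _ _
      _ = 3 := by
        rw [Set.encard_singleton]
        norm_num

/-! ### A triangle from Euler's formula -/

namespace RotationSystem

lemma facePerm_fst (R : G.RotationSystem) (d : G.Dart) : (R.facePerm d).fst = d.snd :=
  ((R.sameCycle_next_iff d.symm (R.next d.symm)).1 ⟨1, rfl⟩).symm

lemma facePerm_pow_faceLength [Finite V] (R : G.RotationSystem) (d : G.Dart) :
    (R.facePerm ^ R.faceLength (R.faceOf d)) d = d := by
  classical
  have := Fintype.ofFinite V
  have hne : R.facePerm d ≠ d := fun e => d.fst_ne_snd (by rw [← R.facePerm_fst d, e])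
  have hset : {d' : G.Dart | R.faceOf d' = R.faceOf d} =
      ((R.facePerm.cycleOf d).support : Set _) := by
    ext d'
    rw [Finset.mem_coe, Equiv.Perm.mem_support_cycleOf_iff' hne]
    exact Quotient.eq.trans Equiv.Perm.sameCycle_comm
  rw [faceLength, hset, Set.ncard_coe_finset]
  simpa using
    (R.facePerm.pow_mod_card_support_cycleOf_self_apply (R.facePerm.cycleOf d).support.card d).symm

lemma exists_triangle_of_faceLength_eq_three [Finite V] (R : G.RotationSystem) {f : R.Face}
    (hf : R.faceLength f = 3) : ∃ v x y, G.Adj v x ∧ G.Adj x y ∧ G.Adj y v := by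
  obtain ⟨d, rfl⟩ := Quotient.exists_rep f
  have h3 := R.facePerm_pow_faceLength d
  rw [show R.faceLength (R.faceOf d) = 3 from hf] at h3
  refine ⟨d.fst, (R.facePerm d).fst, (R.facePerm (R.facePerm d)).fst, ?_, ?_, ?_⟩
  · rw [facePerm_fst]
    exact d.adj
  · rw [R.facePerm_fst (R.facePerm d)]
    exact (R.facePerm d).adj
  · have h := (R.facePerm (R.facePerm d)).adj
    rw [← R.facePerm_fst] at h
    have e : R.facePerm (R.facePerm (R.facePerm d)) = d := h3
    rwa [e] at h

lemma sum_faceLength [Fintype G.Dart] (R : G.RotationSystem) [Fintype R.Face] :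
    ∑ f, R.faceLength f = Fintype.card G.Dart := by
  classical
  rw [← Finset.card_univ,
    Finset.card_eq_sum_card_fiberwise (f := R.faceOf) (t := Finset.univ) (by simp)]
  refine Finset.sum_congr rfl fun f _ => ?_
  rw [faceLength, Set.ncard_eq_toFinset_card']
  congr 1
  ext d
  simp

end RotationSystem

lemma IsThreeSixFullerene.exists_faceLength_eq_three [Finite V] [G.LocallyFinite]
    {R : G.RotationSystem} (hG : G.IsThreeSixFullerene R) : ∃ f, R.faceLength f = 3 := by
  classical
  have := Fintype.ofFinite V
  have : Finite R.Face := Quotient.finite _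
  have := Fintype.ofFinite R.Face
  by_contra! hno
  have hsix : ∀ f, R.faceLength f = 6 := fun f => (hG.face f).resolve_left (hno f)
  have hF := R.sum_faceLength
  rw [Finset.sum_congr rfl fun f _ => hsix f, Finset.sum_const, Finset.card_univ, smul_eq_mul,
    dart_card_eq_twice_card_edges] at hF
  have hE := G.sum_degrees_eq_twice_card_edges.symm.trans
    (Finset.sum_congr (g := fun _ => 3) rfl fun v _ =>
      (by convert hG.cubic v : _ = 3))
  rw [Finset.sum_const, Finset.card_univ, smul_eq_mul] at hE
  have hplane := hG.plane
  rw [RotationSystem.IsPlane, Nat.card_eq_fintype_card, Nat.card_eq_fintype_card,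
    Set.ncard_eq_toFinset_card', ← edgeFinset] at hplane
  omega

end SimpleGraph

open SimpleGraph in
theorem mainTheorem4 {V : Type*} [Finite V] (G : SimpleGraph V) [G.LocallyFinite]
    (R : G.RotationSystem) (hG : G.IsThreeSixFullerene R) :
    G.antiKekuleNumber = 3 := by
  classical
  have := Fintype.ofFinite V
  refine le_antisymm ?_ ?_
  · have h3 : ∀ v, (G.neighborSet v).ncard = 3 := by
      intro v
      rw [← hG.cubic v, ← card_neighborSet_eq_degree, ← Nat.card_eq_fintype_card,
        Nat.card_coe_set_eq]
    obtain ⟨f, hf⟩ := hG.exists_faceLength_eq_three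
    obtain ⟨v, x, y, hvx, hxy, hyv⟩ := R.exists_triangle_of_faceLength_eq_three hf
    obtain ⟨S, hS, hcard⟩ := exists_isAntiKekuleSet_of_triangle hG.twoConnected h3 hvx hxy hyv
    exact (iInf₂_le S hS).trans hcard
  · refine le_iInf₂ fun S hS => ?_
    by_contra hlt
    have hfin : (S.toFinite.toFinset : Set (Sym2 V)) = S := S.toFinite.coe_toFinset
    have hle : S.toFinite.toFinset.card ≤ 2 := by
      rw [← hfin, Set.encard_coe_eq_coe_finsetCard, not_le] at hlt
      have : S.toFinite.toFinset.card < 3 := by exact_mod_cast hlt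
      omega
    have hM := exists_isPerfectMatching_deleteEdges (hG.cubic.of_locallyFinite _)
      (fun C hC => three_le_card_dartBoundary hG.twoConnected (hG.cubic.of_locallyFinite _) hC) _ hle
    rw [hfin] at hM
    exact hS.no_perfectMatching hM
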